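/- Let $\ell\ge 2$ be an integer and let $(F_n^{(\ell)})_{n\ge 2-\ell}$ be the $\ell$-generalized Fibonacci sequence: $F_{2-\ell}^{(\ell)}=\cdots=F_0^{(\ell)}=0$, $F_1^{(\ell)}=1$, and $F_n^{(\ell)}=F_{n-1}^{(\ell)}+\cdots+F_{n-\ell}^{(\ell)}$ for $n\ge 2$. Let $\alpha>1$ be the dominant (real) root of $x^\ell-x^{\ell-1}-\cdots-x-1$ and let $\alpha_2,\dots,\alpha_\ell\in\mathbb{C}$ be its other roots. For a root $z$ put $w(z)=\dfrac{z-1}{2+(\ell+1)(z-2)}\,z^{-1}$, and let $\log$ be the principal logarithm, with imaginary part in $(-\pi,\pi]$. For $n\in\mathbb{Z}$ and $k_2,\dots,k_\ell\in\mathbb{N}_0$, with $k=k_2+\cdots+k_\ell$, put $$s_{k,k_2,\dots,k_\ell,n}=-k+\frac{2n\pi i+k_2\log\alpha_2+\cdots+k_\ell\log\alpha_\ell}{\log\alpha}.$$ Then the function $\zeta_{F^{(\ell)}}(s)=\sum_{n\ge 1}(F_n^{(\ell)})^{-s}$, where the series converges absolutely for $\operatorname{Re}(s)>0$, extends to a meromorphic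 function on $\mathbb{C}$ that is holomorphic outside the set of all points $s_{k,k_2,\dots,k_\ell,n}$ and has at most a simple pole at each of them. Moreover, for all $n\in\mathbb{Z}$ and $k_2,\dots,k_\ell\in\mathbb{N}_0$, with $k=k_2+\cdots+k_\ell$ and $s_0=s_{k,k_2,\dots,k_\ell,n}$, the residue of $\zeta_{F^{(\ell)}}$ at $s_0$ is $$w(\alpha)^{-s_0}\binom{-s_0}{k}\,w(\alpha)^{-k}\,\frac{k!}{k_2!\cdots k_\ell!}\prod_{i=2}^{\ell}w(\alpha_i)^{k_i}\cdot\frac{1}{\log\alpha}.$$ -/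

import Mathlib

open Filter Topology

/-- The recurrence `u (m + ℓ) = u (m + ℓ - 1) + ⋯ + u m` of order `ℓ`. -/
def fibRecurrence (ℓ : ℕ) : LinearRecurrence ℕ where
  order := ℓ
  coeffs := fun _ => 1

/-- The `n`-th `ℓ`-generalized Fibonacci number, for `n ≥ 0` and `ℓ ≥ 2`. The solution `u` of the
recurrence with initial values `0, …, 0, 1` is the sequence started at index `2 - ℓ`, that is,
`u m` is the generalized Fibonacci number of index `m - (ℓ - 2)`. -/
def genFib (ℓ n : ℕ) : ℕ :=
  (fibRecurrence ℓ).mkSol (fun j : Fin ℓ => if (j : ℕ) + 1 = ℓ then 1 else 0) (n + (ℓ - 2))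

/-- The characteristic polynomial `X ^ ℓ - X ^ (ℓ - 1) - ⋯ - X - 1`. -/
noncomputable def fibPoly (ℓ : ℕ) : Polynomial ℂ :=
  Polynomial.X ^ ℓ - ∑ i ∈ Finset.range ℓ, Polynomial.X ^ i

/-- The Binet weight `(z - 1) / (2 + (ℓ + 1) (z - 2)) * z⁻¹` of a root `z`, so that the `n`-th
generalized Fibonacci number is the sum over the roots `z` of `binetWeight ℓ z * z ^ n`. -/
noncomputable def binetWeight (ℓ : ℕ) (z : ℂ) : ℂ :=
  (z - 1) / (2 + ((ℓ : ℂ) + 1) * (z - 2)) * z⁻¹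

/-- The point `-k + (2 n π i + ∑ i, k i * log (β i)) / log α`, where `k = ∑ i, k i`; here `α` is the
dominant root and `β` enumerates the other ones. `Complex.log` is the principal logarithm, with
imaginary part in `(-π, π]`. -/
noncomputable def polePoint {m : ℕ} (α : ℝ) (β : Fin m → ℂ) (k : Fin m → ℕ) (n : ℤ) : ℂ :=
  -((∑ i, k i : ℕ) : ℂ) +
    (2 * (n : ℂ) * (Real.pi : ℂ) * Complex.I + ∑ i, (k i : ℂ) * Complex.log (β i)) /
      (Real.log α : ℂ)

/-- `R` is the residue of `f` at the isolated singularity `z₀`: the integral of `f` over every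
sufficiently small positively oriented circle around `z₀`, divided by `2 π i`, is `R`. -/
def IsResidueAt (f : ℂ → ℂ) (z₀ R : ℂ) : Prop :=
  ∀ᶠ r in 𝓝[>] (0 : ℝ), CircleIntegrable f z₀ r ∧
    (2 * (Real.pi : ℂ) * Complex.I)⁻¹ * (∮ z in C(z₀, r), f z) = R

/-!
Let `f` be the characteristic polynomial, with dominant root `α` and other roots `β i`.

*Roots.* Equality in the triangle inequalities coming from `f z = 0` and from
`(z - 1) * f z = z ^ (ℓ + 1) - 2 * z ^ ℓ + 1` shows that the `β i` lie in the open unit disc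
(`norm_root_lt_one`). The roots are simple, and the Binet weight of `z` is `z ^ (ℓ - 2) / f' z`, so
that Binet's formula (`genFib_eq_sum`) is Euler's identity for the sums of `z ^ m / f' z`.

*Continuation.* Binet's formula reads `F n = w * α ^ n * (1 + ∑ i, κ i * (β i / α) ^ n)`, where
`w = binetWeight ℓ α` is positive and `κ i = binetWeight ℓ (β i) / w`. For `n ≥ N` with `N` large,
expand the power `-s` of the last factor by the binomial series and the multinomial theorem. This
gives a series over multi-indices `k`, absolutely summable jointly with the sum over `n` if
`0 < re s`, and the sum over `n ≥ N` first yields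
`w ^ (-s) * ∑' k, (coefficient of k at -s) * q k s ^ N / (1 - q k s)` with
`q k s = α ^ (-s) * ∏ i, (β i / α) ^ k i` (`hasSum_tsum_poleTerm`). On a disc all but finitely many
`q k` are at most `1 / 2` in modulus, and the remaining terms are dominated by a multiple of
`∏ i, (1 / 2) ^ k i`, so the series is meromorphic on all of `ℂ`
(`exists_analyticAt_tsum_poleTerm`); the finitely many `n < N` contribute an entire function.
The term of `k` has simple poles where `q k s = 1`, which are the points `polePoint α β k n`.

*Residues.* The residue formula requires that different `k` have no pole in common. A coincidence
is a multiplicative relation between the roots, and there are none but the obvious ones, by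
Mignotte's argument for Pisot numbers (`exponents_of_monomial_eq`): all roots are conjugate to `α`,
as the constant term of the minimal polynomial of a root is a nonzero integer
(`isConjRoot_dominant`), so an automorphism moves a root with the largest exponent to `α`, and all
the other roots into the unit disc. Comparison with the relation `(∏ roots) ^ 2 = 1` then shows that
all exponents are equal.
-/

/-! ### Roots of the characteristic polynomial and Binet's formula -/

lemma eval_fibPoly (ℓ : ℕ) (z : ℂ) :
    (fibPoly ℓ).eval z = z ^ ℓ - ∑ i ∈ Finset.range ℓ, z ^ i := by
  simp [fibPoly, Polynomial.eval_finsetSum]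

lemma degree_geom_sum_lt (ℓ : ℕ) :
    (∑ i ∈ Finset.range ℓ, (Polynomial.X : Polynomial ℂ) ^ i).degree < (ℓ : WithBot ℕ) := by
  refine (Polynomial.degree_sum_le _ _).trans_lt ?_
  refine (Finset.sup_lt_iff (WithBot.bot_lt_coe ℓ)).2 fun i hi => ?_
  rw [Polynomial.degree_X_pow]
  exact Nat.cast_lt.2 (Finset.mem_range.1 hi)

lemma fibPoly_monic (ℓ : ℕ) : (fibPoly ℓ).Monic :=
  Polynomial.monic_X_pow_sub (by
    have := degree_geom_sum_lt ℓ
    exact this)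

lemma natDegree_fibPoly (ℓ : ℕ) : (fibPoly ℓ).natDegree = ℓ := by
  have h : (fibPoly ℓ).degree = ℓ := by
    rw [fibPoly, Polynomial.degree_sub_eq_left_of_degree_lt, Polynomial.degree_X_pow]
    rw [Polynomial.degree_X_pow]
    exact degree_geom_sum_lt ℓ
  exact Polynomial.natDegree_eq_of_degree_eq_some h

lemma X_sub_one_mul_fibPoly (ℓ : ℕ) :
    (Polynomial.X - 1) * fibPoly ℓ = Polynomial.X ^ (ℓ + 1) - 2 * Polynomial.X ^ ℓ + 1 := by
  rw [fibPoly, mul_sub, mul_geom_sum]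
  ring

/-- The derivative of the characteristic polynomial at one of its roots, up to the factor `z - 1`;
this is what ties the Binet weight to the derivative. -/
lemma sub_one_mul_eval_derivative_fibPoly {ℓ : ℕ} (hℓ : 1 ≤ ℓ) {z : ℂ}
    (hz : (fibPoly ℓ).eval z = 0) :
    (z - 1) * (fibPoly ℓ).derivative.eval z = z ^ (ℓ - 1) * (2 + ((ℓ : ℂ) + 1) * (z - 2)) := by
  obtain ⟨p, rfl⟩ : ∃ p, ℓ = p + 1 := ⟨ℓ - 1, by omega⟩
  have h := congrArg (fun p => (Polynomial.derivative p).eval z) (X_sub_one_mul_fibPoly (p + 1))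
  have h2 : (2 : Polynomial ℂ) = Polynomial.C 2 := rfl
  simp [Polynomial.derivative_mul, hz, h2] at h
  rw [h]
  simp only [Nat.add_sub_cancel]
  push_cast
  ring

lemma pow_sub_pow_fib {ℓ : ℕ} {z : ℂ} (hz : (fibPoly ℓ).eval z = 0) :
    2 * z ^ ℓ = z ^ (ℓ + 1) + 1 := by
  have h := congrArg (fun p => p.eval z) (X_sub_one_mul_fibPoly ℓ)
  simp only [Polynomial.eval_mul, hz, mul_zero, Polynomial.eval_add, Polynomial.eval_sub,
    Polynomial.eval_pow, Polynomial.eval_X, Polynomial.eval_one, Polynomial.eval_ofNat] at h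
  linear_combination h

/-- The characteristic polynomial has only one positive root, since `x ↦ ∑ x ^ (i - ℓ)` decreases. -/
lemma pos_root_unique {ℓ : ℕ} (hℓ : 1 ≤ ℓ) {x y : ℝ} (hx : 0 < x) (hy : 0 < y)
    (hxr : x ^ ℓ = ∑ i ∈ Finset.range ℓ, x ^ i) (hyr : y ^ ℓ = ∑ i ∈ Finset.range ℓ, y ^ i) :
    x = y := by
  have key : ∀ {x y : ℝ}, 0 < x → x < y → x ^ ℓ = ∑ i ∈ Finset.range ℓ, x ^ i →
      y ^ ℓ = ∑ i ∈ Finset.range ℓ, y ^ i → False := by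
    intro x y hx hxy hxr hyr
    have h1 : y ^ ℓ * x ^ ℓ = ∑ i ∈ Finset.range ℓ, y ^ ℓ * x ^ i := by
      rw [← Finset.mul_sum, ← hxr]
    have h2 : y ^ ℓ * x ^ ℓ = ∑ i ∈ Finset.range ℓ, x ^ ℓ * y ^ i := by
      rw [← Finset.mul_sum, ← hyr, mul_comm]
    have h3 : ∑ i ∈ Finset.range ℓ, x ^ ℓ * y ^ i < ∑ i ∈ Finset.range ℓ, y ^ ℓ * x ^ i := by
      refine Finset.sum_lt_sum_of_nonempty (by simpa using by omega) fun i hi => ?_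
      have hi' := Finset.mem_range.1 hi
      obtain ⟨d, rfl⟩ : ∃ d, ℓ = i + d := ⟨ℓ - i, by omega⟩
      have hd : x ^ d < y ^ d := pow_lt_pow_left₀ hxy hx.le (by omega)
      have hy : 0 < y := hx.trans hxy
      have : 0 < x ^ i * y ^ i := by positivity
      calc x ^ (i + d) * y ^ i = (x ^ i * y ^ i) * x ^ d := by ring
        _ < (x ^ i * y ^ i) * y ^ d := by gcongr
        _ = y ^ (i + d) * x ^ i := by ring
    linarith
  rcases lt_trichotomy x y with h | h | h
  · exact (key hx h hxr hyr).elim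
  · exact h
  · exact (key hy h hyr hxr).elim

lemma real_root_eq {ℓ : ℕ} {x : ℝ} (hx : (fibPoly ℓ).eval (x : ℂ) = 0) :
    x ^ ℓ = ∑ i ∈ Finset.range ℓ, x ^ i := by
  rw [eval_fibPoly, sub_eq_zero] at hx
  exact_mod_cast hx

/-- Equality in the triangle inequality for `w + 1`. -/
lemma eq_norm_of_norm_add_one {w : ℂ} (h : ‖w + 1‖ = ‖w‖ + 1) : w = ‖w‖ := by
  have h1 : ‖w + 1‖ ^ 2 = (‖w‖ + 1) ^ 2 := by rw [h]
  rw [Complex.sq_norm, Complex.normSq_apply] at h1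
  have h2 : ‖w‖ ^ 2 = w.re * w.re + w.im * w.im := by rw [Complex.sq_norm, Complex.normSq_apply]
  simp only [Complex.add_re, Complex.one_re, Complex.add_im, Complex.one_im] at h1
  have hre : w.re = ‖w‖ := by linarith
  have him : w.im = 0 := by
    rw [← hre] at h2
    have : w.im * w.im = 0 := by linarith
    exact mul_self_eq_zero.1 this
  apply Complex.ext <;> simp [← hre, him]

/-- Every root other than the dominant one lies in the open unit disc: if `1 ≤ ‖z‖`, then both
triangle inequalities coming from `z ^ ℓ = ∑ z ^ i` and `2 z ^ ℓ = z ^ (ℓ + 1) + 1` are equalities,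
so `z` is the positive root. -/
lemma norm_root_lt_one {ℓ : ℕ} (hℓ : 2 ≤ ℓ) {α : ℝ} (hα : 1 < α)
    (hαr : (fibPoly ℓ).eval (α : ℂ) = 0) {z : ℂ} (hz : (fibPoly ℓ).eval z = 0) (hzα : z ≠ α) :
    ‖z‖ < 1 := by
  by_contra hcon
  push Not at hcon
  have hr0 : 0 < ‖z‖ := by linarith
  have h1 := hz
  rw [eval_fibPoly, sub_eq_zero] at h1
  have hle : ‖z‖ ^ ℓ ≤ ∑ i ∈ Finset.range ℓ, ‖z‖ ^ i := by
    rw [← norm_pow, h1]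
    refine (norm_sum_le _ _).trans (le_of_eq ?_)
    simp
  have h2 := pow_sub_pow_fib hz
  have hle2 : 2 * ‖z‖ ^ ℓ ≤ ‖z‖ ^ (ℓ + 1) + 1 := by
    have : ‖2 * z ^ ℓ‖ ≤ ‖z ^ (ℓ + 1)‖ + ‖(1 : ℂ)‖ := by rw [h2]; exact norm_add_le _ _
    simpa using this
  have hgeom := mul_geom_sum ‖z‖ ℓ
  have heq : 2 * ‖z‖ ^ ℓ = ‖z‖ ^ (ℓ + 1) + 1 := by
    have h3 := mul_le_mul_of_nonneg_left hle (sub_nonneg.2 hcon)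
    rw [hgeom] at h3
    refine le_antisymm hle2 ?_
    rw [pow_succ]
    linarith
  have h3 : z ^ (ℓ + 1) = (‖z‖ ^ (ℓ + 1) : ℝ) := by
    have := eq_norm_of_norm_add_one (w := z ^ (ℓ + 1)) (by rw [← h2]; simpa using heq)
    rwa [norm_pow] at this
  have h4 : z ^ ℓ = (‖z‖ ^ ℓ : ℝ) := by
    have : 2 * z ^ ℓ = 2 * ((‖z‖ ^ ℓ : ℝ) : ℂ) := by
      rw [h2, h3]; exact_mod_cast heq.symm
    exact mul_left_cancel₀ two_ne_zero this
  have h5 : z = (‖z‖ : ℝ) := by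
    have hne : ((‖z‖ ^ ℓ : ℝ) : ℂ) ≠ 0 := by exact_mod_cast (pow_pos hr0 ℓ).ne'
    apply mul_left_cancel₀ hne
    rw [← h4, ← pow_succ, h3, h4]
    push_cast
    ring
  rw [h5] at hz
  exact hzα (h5.trans (by
    rw [pos_root_unique (by omega) hr0 (by linarith) (real_root_eq hz) (real_root_eq hαr)]))

/-- The sign of the denominator of the dominant Binet weight, read off from `0 < f' α`. -/
lemma dominant_weight_denominator_pos {ℓ : ℕ} (hℓ : 2 ≤ ℓ) {α : ℝ} (hα : 1 < α)
    (hαr : (fibPoly ℓ).eval (α : ℂ) = 0) : 0 < 2 + ((ℓ : ℝ) + 1) * (α - 2) := by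
  have hr := real_root_eq hαr
  have h0 : 0 < α := by linarith
  -- `α f'(α) ≥ α ^ ℓ`, as the coefficients of `f` below the leading one are negative.
  have hd : 0 < (ℓ : ℝ) * α ^ ℓ - ∑ i ∈ Finset.range ℓ, (i : ℝ) * α ^ i := by
    have : ∑ i ∈ Finset.range ℓ, (i : ℝ) * α ^ i < ∑ i ∈ Finset.range ℓ, (ℓ : ℝ) * α ^ i := by
      refine Finset.sum_lt_sum_of_nonempty (by simpa using by omega) fun i hi => ?_
      have : (i : ℝ) < ℓ := by exact_mod_cast Finset.mem_range.1 hi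
      gcongr
    rw [← Finset.mul_sum, ← hr] at this
    linarith
  have h1 : (α : ℂ) * (fibPoly ℓ).derivative.eval (α : ℂ) =
      (((ℓ : ℝ) * α ^ ℓ - ∑ i ∈ Finset.range ℓ, (i : ℝ) * α ^ i : ℝ) : ℂ) := by
    have hp : ∀ i : ℕ, (α : ℂ) * (i * (α : ℂ) ^ (i - 1)) = i * (α : ℂ) ^ i := by
      rintro (_ | i)
      · simp
      · simp only [Nat.add_sub_cancel, pow_succ]; ring
    simp [fibPoly, Polynomial.eval_finsetSum, Polynomial.derivative_X_pow, mul_sub,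
      Finset.mul_sum, hp]
  have h2 := sub_one_mul_eval_derivative_fibPoly (by omega : 1 ≤ ℓ) hαr
  have h3 : ((α - 1) * ((ℓ : ℝ) * α ^ ℓ - ∑ i ∈ Finset.range ℓ, (i : ℝ) * α ^ i) : ℝ) =
      α * (α ^ (ℓ - 1) * (2 + ((ℓ : ℝ) + 1) * (α - 2))) := by
    have : (((α - 1) * ((ℓ : ℝ) * α ^ ℓ - ∑ i ∈ Finset.range ℓ, (i : ℝ) * α ^ i) : ℝ) : ℂ) =
      ((α * (α ^ (ℓ - 1) * (2 + ((ℓ : ℝ) + 1) * (α - 2))) : ℝ) : ℂ) := by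
      rw [Complex.ofReal_mul (α - 1), ← h1]
      push_cast
      rw [← h2]
      ring
    exact_mod_cast this
  have h4 : 0 < α * (α ^ (ℓ - 1) * (2 + ((ℓ : ℝ) + 1) * (α - 2))) := by
    rw [← h3]; exact mul_pos (by linarith) hd
  have h5 : 0 < α * α ^ (ℓ - 1) := by positivity
  rw [← mul_assoc] at h4
  exact (mul_pos_iff_of_pos_left h5).1 h4

lemma fibPoly_root_ne_zero {ℓ : ℕ} (hℓ : 2 ≤ ℓ) {z : ℂ} (hz : (fibPoly ℓ).eval z = 0) : z ≠ 0 := by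
  rintro rfl
  have := pow_sub_pow_fib hz
  simp [show ℓ ≠ 0 by omega] at this

lemma weight_denominator_ne_zero {ℓ : ℕ} (hℓ : 2 ≤ ℓ) {α : ℝ} (hα : 1 < α)
    (hαr : (fibPoly ℓ).eval (α : ℂ) = 0) {z : ℂ} (hz : (fibPoly ℓ).eval z = 0) :
    2 + ((ℓ : ℂ) + 1) * (z - 2) ≠ 0 := by
  by_cases hzα : z = α
  · have := dominant_weight_denominator_pos hℓ hα hαr
    rw [hzα]
    exact_mod_cast this.ne'
  · have hlt := norm_root_lt_one hℓ hα hαr hz hzα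
    intro h
    -- the only zero is `2 ℓ / (ℓ + 1) > 1`
    have h1 : ((ℓ : ℂ) + 1) * z = 2 * ℓ := by linear_combination h
    have h2 : ((ℓ : ℝ) + 1) * ‖z‖ = 2 * ℓ := by
      have := congrArg norm h1
      rw [norm_mul, norm_mul] at this
      have h3 : ‖(ℓ : ℂ) + 1‖ = (ℓ : ℝ) + 1 := by
        exact_mod_cast Complex.norm_natCast (ℓ + 1)
      rw [h3] at this
      simpa using this
    have h3 : (2 : ℝ) ≤ ℓ := by exact_mod_cast hℓ
    nlinarith

lemma eval_derivative_fibPoly_ne_zero {ℓ : ℕ} (hℓ : 2 ≤ ℓ) {α : ℝ} (hα : 1 < α)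
    (hαr : (fibPoly ℓ).eval (α : ℂ) = 0) {z : ℂ} (hz : (fibPoly ℓ).eval z = 0) :
    (fibPoly ℓ).derivative.eval z ≠ 0 := by
  intro h
  have h1 := sub_one_mul_eval_derivative_fibPoly (by omega) hz
  rw [h, mul_zero] at h1
  exact mul_ne_zero (pow_ne_zero _ (fibPoly_root_ne_zero hℓ hz))
    (weight_denominator_ne_zero hℓ hα hαr hz) h1.symm

lemma binetWeight_eq {ℓ : ℕ} (hℓ : 2 ≤ ℓ) {α : ℝ} (hα : 1 < α)
    (hαr : (fibPoly ℓ).eval (α : ℂ) = 0) {z : ℂ} (hz : (fibPoly ℓ).eval z = 0) :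
    binetWeight ℓ z = z ^ (ℓ - 2) / (fibPoly ℓ).derivative.eval z := by
  have h0 := fibPoly_root_ne_zero hℓ hz
  have hd := weight_denominator_ne_zero hℓ hα hαr hz
  have hf := eval_derivative_fibPoly_ne_zero hℓ hα hαr hz
  have h1 := sub_one_mul_eval_derivative_fibPoly (by omega) hz
  obtain ⟨p, rfl⟩ : ∃ p, ℓ = p + 2 := ⟨ℓ - 2, by omega⟩
  rw [show p + 2 - 1 = p + 1 by omega] at h1
  rw [show p + 2 - 2 = p by omega, binetWeight, ← div_eq_mul_inv, div_div,
    div_eq_div_iff (mul_ne_zero hd h0) hf, h1]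
  ring

lemma binetWeight_dominant {ℓ : ℕ} (hℓ : 2 ≤ ℓ) {α : ℝ} (hα : 1 < α)
    (hαr : (fibPoly ℓ).eval (α : ℂ) = 0) :
    ∃ w : ℝ, 0 < w ∧ binetWeight ℓ (α : ℂ) = w := by
  have := dominant_weight_denominator_pos hℓ hα hαr
  have h0 : 0 < α - 1 := by linarith
  refine ⟨(α - 1) / (2 + ((ℓ : ℝ) + 1) * (α - 2)) * α⁻¹, by positivity, ?_⟩
  rw [binetWeight]
  push_cast
  rfl

section Roots

variable {ℓ : ℕ} {ι : Type*} [Fintype ι] {r : ι → ℂ}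

lemma eval_fibPoly_root (hr : (fibPoly ℓ).roots = Finset.univ.val.map r) (i : ι) :
    (fibPoly ℓ).eval (r i) = 0 :=
  Polynomial.isRoot_of_mem_roots (by rw [hr]; exact Multiset.mem_map_of_mem r (Finset.mem_univ i))

lemma roots_injective (hℓ : 2 ≤ ℓ) {α : ℝ} (hα : 1 < α)
    (hαr : (fibPoly ℓ).eval (α : ℂ) = 0)
    (hr : (fibPoly ℓ).roots = Finset.univ.val.map r) : Function.Injective r := by
  have hnd : (fibPoly ℓ).roots.Nodup := by
    classical
    rw [Multiset.nodup_iff_count_le_one]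
    intro z
    rw [Polynomial.count_roots]
    by_contra hcon
    push Not at hcon
    obtain ⟨h1, h2⟩ :=
      (Polynomial.one_lt_rootMultiplicity_iff_isRoot (fibPoly_monic ℓ).ne_zero).1 hcon
    exact eval_derivative_fibPoly_ne_zero hℓ hα hαr h1 h2
  rw [hr] at hnd
  intro i j hij
  exact Multiset.inj_on_of_nodup_map hnd i (Finset.mem_univ i) j (Finset.mem_univ j) hij

lemma card_roots_index (hr : (fibPoly ℓ).roots = Finset.univ.val.map r) : Fintype.card ι = ℓ := by
  have h1 := (IsAlgClosed.splits (fibPoly ℓ)).natDegree_eq_card_roots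
  rw [hr, natDegree_fibPoly, Multiset.card_map] at h1
  exact h1.symm

lemma nodal_roots (hr : (fibPoly ℓ).roots = Finset.univ.val.map r) :
    Lagrange.nodal Finset.univ r = fibPoly ℓ := by
  have h1 := (IsAlgClosed.splits (fibPoly ℓ)).eq_prod_roots_of_monic (fibPoly_monic ℓ)
  rw [h1, hr, Lagrange.nodal, Multiset.map_map]
  rfl

/-- Euler's identity for the sums of `z ^ m / f'(z)` over the roots of a polynomial. -/
lemma sum_pow_div_derivative (hℓ : 2 ≤ ℓ) {α : ℝ} (hα : 1 < α)
    (hαr : (fibPoly ℓ).eval (α : ℂ) = 0)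
    (hr : (fibPoly ℓ).roots = Finset.univ.val.map r) {m : ℕ} (hm : m < ℓ) :
    ∑ i, r i ^ m / (fibPoly ℓ).derivative.eval (r i) = if m + 1 = ℓ then 1 else 0 := by
  classical
  have hinj := roots_injective hℓ hα hαr hr
  have hcard := card_roots_index hr
  have h := Lagrange.coeff_eq_sum (s := Finset.univ) (v := r) hinj.injOn
    (P := (Polynomial.X : Polynomial ℂ) ^ m) (by
      rw [Polynomial.degree_X_pow, Finset.card_univ, hcard]; exact_mod_cast hm)
  rw [Finset.card_univ, hcard, Polynomial.coeff_X_pow] at h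
  have h2 : (if ℓ - 1 = m then (1 : ℂ) else 0) = if m + 1 = ℓ then 1 else 0 := by
    congr 1
    exact propext ⟨fun h => by omega, fun h => by omega⟩
  rw [← h2, h]
  refine Finset.sum_congr rfl fun i _ => ?_
  rw [← nodal_roots hr, Lagrange.eval_nodal_derivative_eval_node_eq (Finset.mem_univ i),
    Lagrange.eval_nodal, Polynomial.eval_pow, Polynomial.eval_X]

/-- Binet's formula for the generalized Fibonacci numbers. -/
lemma genFib_eq_sum (hℓ : 2 ≤ ℓ) {α : ℝ} (hα : 1 < α)
    (hαr : (fibPoly ℓ).eval (α : ℂ) = 0)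
    (hr : (fibPoly ℓ).roots = Finset.univ.val.map r) (n : ℕ) :
    ((genFib ℓ n : ℕ) : ℂ) = ∑ i, binetWeight ℓ (r i) * r i ^ n := by
  set u := (fibRecurrence ℓ).mkSol (fun j : Fin ℓ => if (j : ℕ) + 1 = ℓ then 1 else 0) with hu
  have key : ∀ m : ℕ, ((u m : ℕ) : ℂ) = ∑ i, r i ^ m / (fibPoly ℓ).derivative.eval (r i) := by
    intro m
    induction m using Nat.strong_induction_on with
    | _ m ih =>
      rcases lt_or_ge m ℓ with hm | hm
      · rw [sum_pow_div_derivative hℓ hα hαr hr hm]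
        have h0 := (fibRecurrence ℓ).mkSol_eq_init
          (fun j : Fin ℓ => if (j : ℕ) + 1 = ℓ then 1 else 0) (⟨m, hm⟩ : Fin ℓ)
        change u m = _ at h0
        rw [h0]
        simp
      · obtain ⟨p, rfl⟩ : ∃ p, m = p + ℓ := ⟨m - ℓ, by omega⟩
        have h0 := (fibRecurrence ℓ).is_sol_mkSol
          (fun j : Fin ℓ => if (j : ℕ) + 1 = ℓ then 1 else 0) p
        change u (p + ℓ) = ∑ i : Fin ℓ, 1 * u (p + i) at h0
        rw [h0]
        push_cast
        have h1 : ∀ i : Fin ℓ, (1 : ℂ) * (u (p + i) : ℂ) =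
            ∑ j, r j ^ (p + (i : ℕ)) / (fibPoly ℓ).derivative.eval (r j) := fun i => by
          rw [one_mul, ih (p + i) (by have := i.2; omega)]
        rw [Finset.sum_congr rfl fun i _ => h1 i, Finset.sum_comm]
        refine Finset.sum_congr rfl fun j _ => ?_
        have h2 := eval_fibPoly_root hr j
        rw [eval_fibPoly, sub_eq_zero, ← Fin.sum_univ_eq_sum_range (fun i => r j ^ i)] at h2
        rw [pow_add, h2, Finset.mul_sum, Finset.sum_div]
        exact Finset.sum_congr rfl fun i _ => by rw [pow_add]
  have h := key (n + (ℓ - 2))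
  rw [genFib, h]
  refine Finset.sum_congr rfl fun i _ => ?_
  rw [binetWeight_eq hℓ hα hαr (eval_fibPoly_root hr i), pow_add]
  ring

end Roots

lemma genFib_succ_pos {ℓ : ℕ} (hℓ : 2 ≤ ℓ) (n : ℕ) : 0 < genFib ℓ (n + 1) := by
  set u := (fibRecurrence ℓ).mkSol (fun j : Fin ℓ => if (j : ℕ) + 1 = ℓ then 1 else 0) with hu
  have key : ∀ m : ℕ, ℓ ≤ m + 1 → 0 < u m := by
    intro m
    induction m using Nat.strong_induction_on with
    | _ m ih =>
      intro hm
      rcases Nat.lt_or_ge m ℓ with h | h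
      · have h0 := (fibRecurrence ℓ).mkSol_eq_init
          (fun j : Fin ℓ => if (j : ℕ) + 1 = ℓ then 1 else 0) (⟨m, h⟩ : Fin ℓ)
        change u m = _ at h0
        rw [h0]
        simp [show m + 1 = ℓ by omega]
      · obtain ⟨p, rfl⟩ : ∃ p, m = p + ℓ := ⟨m - ℓ, by omega⟩
        have h0 := (fibRecurrence ℓ).is_sol_mkSol
          (fun j : Fin ℓ => if (j : ℕ) + 1 = ℓ then 1 else 0) p
        change u (p + ℓ) = ∑ i : Fin ℓ, 1 * u (p + i) at h0
        rw [h0]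
        have hlast := ih (p + (ℓ - 1)) (by omega) (by omega)
        have := Finset.single_le_sum (f := fun i : Fin ℓ => 1 * u (p + i))
          (fun i _ => Nat.zero_le _) (Finset.mem_univ (⟨ℓ - 1, by omega⟩ : Fin ℓ))
        simp only [one_mul] at this ⊢
        omega
  exact key _ (by omega)

/-! ### Multiplicative relations between the roots -/

/-- Conjugate elements of an algebraically closed field are exchanged by a homomorphism defined on
all algebraic elements. -/
lemma exists_ringHom_of_isConjRoot {F E : Type*} [Field F] [Field E] [Algebra F E] [IsAlgClosed E]
    {x y : E} (hx : x ∈ algebraicClosure F E) (h : IsConjRoot F y x) :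
    ∃ σ : algebraicClosure F E →+* E, σ ⟨x, hx⟩ = y := by
  have hn : Normal F (algebraicClosure F E) := IsAlgClosure.normal F _
  have hy : y ∈ algebraicClosure F E := by
    rw [mem_algebraicClosure_iff] at hx ⊢
    exact (h.isIntegral_iff.2 hx.isIntegral).isAlgebraic
  have h' : IsConjRoot F (⟨y, hy⟩ : algebraicClosure F E) ⟨x, hx⟩ :=
    (isConjRoot_algHom_iff (algebraicClosure F E).val).1 h
  obtain ⟨σ, hσ⟩ := isConjRoot_iff_exists_algEquiv.1 h'
  refine ⟨(algebraicClosure F E).val.toRingHom.comp σ.toRingEquiv.toRingHom, ?_⟩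
  change ((σ ⟨x, hx⟩ : algebraicClosure F E) : E) = y
  rw [hσ]

lemma fibPoly_root_isIntegral {ℓ : ℕ} {z : ℂ} (hz : (fibPoly ℓ).eval z = 0) : IsIntegral ℤ z := by
  refine ⟨Polynomial.X ^ ℓ - ∑ i ∈ Finset.range ℓ, Polynomial.X ^ i, ?_, ?_⟩
  · refine Polynomial.monic_X_pow_sub ?_
    refine (Polynomial.degree_sum_le _ _).trans_lt ?_
    refine (Finset.sup_lt_iff (WithBot.bot_lt_coe ℓ)).2 fun i hi => ?_
    rw [Polynomial.degree_X_pow]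
    exact Nat.cast_lt.2 (Finset.mem_range.1 hi)
  · rw [eval_fibPoly] at hz
    simpa [Polynomial.eval₂_finsetSum] using hz

lemma norm_multiset_prod_le_one {s : Multiset ℂ} (h : ∀ z ∈ s, ‖z‖ ≤ 1) : ‖s.prod‖ ≤ 1 := by
  induction s using Multiset.induction_on with
  | empty => simp
  | cons a t ih =>
    rw [Multiset.prod_cons, norm_mul]
    exact mul_le_one₀ (h a (Multiset.mem_cons_self a t)) (norm_nonneg _)
      (ih fun z hz => h z (Multiset.mem_cons_of_mem hz))

/-- Every root is conjugate to the dominant one: otherwise its minimal polynomial over `ℤ` would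
have all its roots in the open unit disc, so its constant term, an integer, would vanish. -/
lemma isConjRoot_dominant {ℓ : ℕ} (hℓ : 2 ≤ ℓ) {α : ℝ} (hα : 1 < α)
    (hαr : (fibPoly ℓ).eval (α : ℂ) = 0) {z : ℂ} (hz : (fibPoly ℓ).eval z = 0) :
    IsConjRoot ℚ (α : ℂ) z := by
  have hint := fibPoly_root_isIntegral hz
  set p := minpoly ℤ z with hp
  have hmon : p.Monic := minpoly.monic hint
  set P : Polynomial ℂ := p.map (algebraMap ℤ ℂ) with hP
  have hPmon : P.Monic := hmon.map _
  have hroot : ∀ x : ℂ, P.IsRoot x → (fibPoly ℓ).eval x = 0 := by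
    intro x hx
    set f : Polynomial ℤ := Polynomial.X ^ ℓ - ∑ i ∈ Finset.range ℓ, Polynomial.X ^ i with hf
    have hmap : f.map (algebraMap ℤ ℂ) = fibPoly ℓ := by
      simp [hf, fibPoly, Polynomial.map_sum]
    have hdvd : p ∣ f := by
      apply minpoly.isIntegrallyClosed_dvd hint
      rw [Polynomial.aeval_def, ← Polynomial.eval_map, hmap, hz]
    have := Polynomial.map_dvd (algebraMap ℤ ℂ) hdvd
    rw [hmap] at this
    exact hx.dvd this
  have hPz : P.IsRoot z := by
    rw [hP, Polynomial.IsRoot, Polynomial.eval_map, ← Polynomial.aeval_def]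
    exact minpoly.aeval ℤ z
  have hPα : P.IsRoot (α : ℂ) := by
    by_contra hcon
    have hlt : ∀ x ∈ P.roots, ‖x‖ < 1 := fun x hx => by
      have hx' := Polynomial.isRoot_of_mem_roots hx
      exact norm_root_lt_one hℓ hα hαr (hroot x hx') (by rintro rfl; exact hcon hx')
    have hzmem : z ∈ P.roots := (Polynomial.mem_roots hPmon.ne_zero).2 hPz
    obtain ⟨t, ht⟩ := Multiset.exists_cons_of_mem hzmem
    have h0 := (IsAlgClosed.splits P).coeff_zero_eq_prod_roots_of_monic hPmon
    have hnorm : ‖P.coeff 0‖ < 1 := by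
      rw [h0, norm_mul, norm_pow, norm_neg, norm_one, one_pow, one_mul, ht, Multiset.prod_cons,
        norm_mul]
      exact mul_lt_one_of_nonneg_of_lt_one_left (norm_nonneg _) (hlt z hzmem)
        (norm_multiset_prod_le_one fun x hx => (hlt x (by
          rw [ht]; exact Multiset.mem_cons_of_mem hx)).le)
    have hc : p.coeff 0 = 0 := by
      rw [hP, Polynomial.coeff_map] at hnorm
      simp only [algebraMap_int_eq, eq_intCast, Complex.norm_intCast] at hnorm
      exact Int.abs_lt_one_iff.1 (by exact_mod_cast hnorm)
    have hroot0 : P.IsRoot 0 := by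
      rw [Polynomial.IsRoot, ← Polynomial.coeff_zero_eq_eval_zero, hP, Polynomial.coeff_map, hc,
        map_zero]
    exact fibPoly_root_ne_zero hℓ (hroot 0 hroot0) rfl
  symm
  refine isConjRoot_of_aeval_eq_zero hint.tower_top ?_
  rw [minpoly.isIntegrallyClosed_eq_field_fractions' ℚ hint, Polynomial.aeval_map_algebraMap,
    Polynomial.aeval_def, ← Polynomial.eval_map]
  exact hPα

lemma prod_roots_sq {ℓ : ℕ} (hℓ : 2 ≤ ℓ) {ι : Type*} [Fintype ι] {r : ι → ℂ}
    (hr : (fibPoly ℓ).roots = Finset.univ.val.map r) : (∏ i, r i) ^ 2 = 1 := by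
  have h0 := (IsAlgClosed.splits (fibPoly ℓ)).coeff_zero_eq_prod_roots_of_monic (fibPoly_monic ℓ)
  rw [Polynomial.coeff_zero_eq_eval_zero, eval_fibPoly, hr, natDegree_fibPoly] at h0
  have h1 : ∑ i ∈ Finset.range ℓ, (0 : ℂ) ^ i = 1 := by
    obtain ⟨p, rfl⟩ : ∃ p, ℓ = p + 1 := ⟨ℓ - 1, by omega⟩
    rw [Finset.sum_range_succ']
    simp
  rw [h1, zero_pow (by omega), zero_sub] at h0
  have h2 : (∏ i, r i) = (Finset.univ.val.map r).prod := rfl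
  have h3 : ((-1 : ℂ) ^ ℓ) ^ 2 = 1 := by rw [← pow_mul, mul_comm, pow_mul]; simp
  calc (∏ i, r i) ^ 2 = ((-1 : ℂ) ^ ℓ) ^ 2 * (∏ i, r i) ^ 2 := by rw [h3, one_mul]
    _ = ((-1) ^ ℓ * (∏ i, r i)) ^ 2 := by ring
    _ = 1 := by rw [h2, ← h0]; norm_num

/-- Multiplicative relations between the roots are trivial (Mignotte's argument for Pisot numbers):
the exponents of two equal monomials differ by a constant. Let `d i = a i - b i`, and move a root at
which `d` is maximal to the dominant root by an automorphism. With `x i` for the images of the roots,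
all terms of `∑ (d i - max d) * log ‖x i‖ = 0` are nonnegative, so they vanish. -/
lemma exponents_of_monomial_eq {ℓ : ℕ} (hℓ : 2 ≤ ℓ) {α : ℝ} (hα : 1 < α)
    (hαr : (fibPoly ℓ).eval (α : ℂ) = 0) {ι : Type*} [Fintype ι] {r : ι → ℂ}
    (hr : (fibPoly ℓ).roots = Finset.univ.val.map r) {a b : ι → ℕ}
    (hab : ∏ i, r i ^ a i = ∏ i, r i ^ b i) (i j : ι) :
    (a i : ℤ) - b i = a j - b j := by
  have : Nonempty ι := ⟨i⟩
  obtain ⟨m, hm⟩ := Finite.exists_max fun i => (a i : ℤ) - b i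
  suffices h : ∀ i, (a i : ℤ) - b i = a m - b m by rw [h i, h j]
  have hmem : ∀ i, r i ∈ algebraicClosure ℚ ℂ := fun i => by
    rw [mem_algebraicClosure_iff]
    have h1 : IsIntegral ℚ (r i) := (fibPoly_root_isIntegral (eval_fibPoly_root hr i)).tower_top
    exact h1.isAlgebraic
  obtain ⟨σ, hσ⟩ := exists_ringHom_of_isConjRoot (hmem m)
    (isConjRoot_dominant hℓ hα hαr (eval_fibPoly_root hr m))
  set y : ι → algebraicClosure ℚ ℂ := fun i => ⟨r i, hmem i⟩ with hy
  have hyr : ∀ i, (algebraicClosure ℚ ℂ).val (y i) = r i := fun i => rfl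
  have hvinj : Function.Injective (algebraicClosure ℚ ℂ).val := Subtype.val_injective
  set x : ι → ℂ := fun i => σ (y i) with hx
  have hyinj : Function.Injective y := fun i j h =>
    roots_injective hℓ hα hαr hr (congrArg Subtype.val h)
  have hxinj : Function.Injective x := σ.injective.comp hyinj
  have hxm : x m = α := hσ
  have hxroot : ∀ i, (fibPoly ℓ).eval (x i) = 0 := fun i => by
    have h1 : y i ^ ℓ = ∑ j ∈ Finset.range ℓ, y i ^ j := by
      apply hvinj
      have h2 := eval_fibPoly_root hr i
      rw [eval_fibPoly, sub_eq_zero] at h2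
      rw [map_pow, map_sum, hyr, h2]
      exact Finset.sum_congr rfl fun j _ => by rw [map_pow, hyr]
    rw [eval_fibPoly, sub_eq_zero, hx]
    simp only
    rw [← map_pow, h1, map_sum]
    exact Finset.sum_congr rfl fun j _ => by rw [map_pow]
  have hx0 : ∀ i, 0 < ‖x i‖ := fun i => norm_pos_iff.2 (fibPoly_root_ne_zero hℓ (hxroot i))
  have hxlt : ∀ i, i ≠ m → ‖x i‖ < 1 := fun i hi =>
    norm_root_lt_one hℓ hα hαr (hxroot i) (by rw [← hxm]; exact hxinj.ne hi)
  have hprod : ∑ i, Real.log ‖x i‖ = 0 := by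
    have h1 : (∏ i, y i) ^ 2 = 1 := by
      apply hvinj
      rw [map_pow, map_prod, map_one]
      exact prod_roots_sq hℓ hr
    have h2 : (∏ i, x i) ^ 2 = 1 := by
      have := congrArg σ h1
      rwa [map_pow, map_prod, map_one] at this
    have h3 : ∏ i, ‖x i‖ = 1 := by
      have := congrArg norm h2
      rw [norm_pow, norm_prod, norm_one] at this
      exact (pow_eq_one_iff_of_nonneg (Finset.prod_nonneg fun i _ => norm_nonneg _)
        two_ne_zero).1 this
    rw [← Real.log_prod fun i _ => (hx0 i).ne', h3, Real.log_one]
  have hab' : ∑ i, (a i : ℝ) * Real.log ‖x i‖ = ∑ i, (b i : ℝ) * Real.log ‖x i‖ := by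
    have h1 : ∏ i, y i ^ a i = ∏ i, y i ^ b i := by
      apply hvinj
      simp only [map_prod, map_pow, hyr]
      exact hab
    have h2 : ∏ i, x i ^ a i = ∏ i, x i ^ b i := by
      have := congrArg σ h1
      simpa only [map_prod, map_pow] using this
    have h3 := congrArg (fun z => Real.log ‖z‖) h2
    simp only [norm_prod, norm_pow] at h3
    rw [Real.log_prod fun i _ => (pow_pos (hx0 i) _).ne',
      Real.log_prod fun i _ => (pow_pos (hx0 i) _).ne'] at h3
    simpa only [Real.log_pow] using h3
  have hsum : ∑ i, (((a i : ℝ) - b i) - (a m - b m)) * Real.log ‖x i‖ = 0 := by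
    simp only [sub_mul, Finset.sum_sub_distrib, ← Finset.mul_sum, hprod, hab']
    ring
  have hmR : ∀ i, ((a i : ℝ) - b i) - (a m - b m) ≤ 0 := fun i => by
    have h1 := hm i
    have h2 : ((a i : ℤ) - b i : ℤ) - ((a m : ℤ) - b m) ≤ 0 := by simpa using h1
    exact_mod_cast h2
  have hnonneg : ∀ i ∈ Finset.univ,
      0 ≤ (((a i : ℝ) - b i) - (a m - b m)) * Real.log ‖x i‖ := fun i _ => by
    by_cases hi : i = m
    · rw [hi]; simp
    · exact mul_nonneg_of_nonpos_of_nonpos (hmR i)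
        (Real.log_nonpos (norm_nonneg _) (hxlt i hi).le)
  have hzero := (Finset.sum_eq_zero_iff_of_nonneg hnonneg).1 hsum
  intro i
  by_cases hi : i = m
  · rw [hi]
  · have hlog : Real.log ‖x i‖ ≠ 0 := (Real.log_neg (hx0 i) (hxlt i hi)).ne
    have h1 := (mul_eq_zero.1 (hzero i (Finset.mem_univ i))).resolve_right hlog
    have h2 : ((a i : ℤ) - b i : ℤ) - ((a m : ℤ) - b m) = 0 := by exact_mod_cast h1
    linarith

/-! ### Multi-index series -/

lemma summable_prod_pow {ι : Type*} [Fintype ι] {x : ι → ℝ} (h0 : ∀ i, 0 ≤ x i)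
    (h1 : ∀ i, x i < 1) : Summable fun k : ι → ℕ => ∏ i, x i ^ k i := by
  classical
  refine summable_of_sum_le (c := ∏ i, (1 - x i)⁻¹)
    (fun k => Finset.prod_nonneg fun i _ => pow_nonneg (h0 i) _) fun u => ?_
  obtain ⟨M, hM⟩ : ∃ M, ∀ k ∈ u, ∀ i, k i < M := by
    refine ⟨∑ k ∈ u, ∑ i, k i + 1, fun k hk i => Nat.lt_succ_of_le ?_⟩
    exact (Finset.single_le_sum (f := fun i => k i) (fun _ _ => Nat.zero_le _)
      (Finset.mem_univ i)).trans (Finset.single_le_sum (f := fun k : ι → ℕ => ∑ i, k i)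
        (fun _ _ => Nat.zero_le _) hk)
  calc ∑ k ∈ u, ∏ i, x i ^ k i
      ≤ ∑ k ∈ Fintype.piFinset fun _ : ι => Finset.range M, ∏ i, x i ^ k i := by
        refine Finset.sum_le_sum_of_subset_of_nonneg (fun k hk => ?_)
          fun k _ _ => Finset.prod_nonneg fun i _ => pow_nonneg (h0 i) _
        exact Fintype.mem_piFinset.2 fun i => Finset.mem_range.2 (hM k hk i)
    _ = ∏ i, ∑ j ∈ Finset.range M, x i ^ j :=
        (Finset.prod_univ_sum (fun _ => Finset.range M) fun i j => x i ^ j).symm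
    _ ≤ ∏ i, (1 - x i)⁻¹ := by
        refine Finset.prod_le_prod
          (fun i _ => Finset.sum_nonneg fun j _ => pow_nonneg (h0 i) _) fun i _ => ?_
        rw [← tsum_geometric_of_lt_one (h0 i) (h1 i)]
        exact (summable_geometric_of_lt_one (h0 i) (h1 i)).sum_le_tsum _
          fun j _ => pow_nonneg (h0 i) _

lemma choose_eq_prod_div_factorial (z : ℂ) (k : ℕ) :
    Ring.choose z k = (∏ j ∈ Finset.range k, (z - j)) / (k.factorial : ℂ) := by
  rw [Ring.choose_eq_smul, ← Polynomial.aeval_eq_smeval, Polynomial.aeval_def,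
    ← Polynomial.eval_map, descPochhammer_map, descPochhammer_eval_eq_prod_range, smul_eq_mul]
  ring

lemma norm_choose_neg_le {s : ℂ} {R : ℕ} (hs : ‖s‖ ≤ R) (k : ℕ) :
    ‖Ring.choose (-s) k‖ ≤ ((R + k).choose k : ℝ) := by
  induction k with
  | zero => simp
  | succ k ih =>
    have hk : (0 : ℝ) < k + 1 := by positivity
    have h1 : Ring.choose (-s) (k + 1) * ((k : ℂ) + 1) = Ring.choose (-s) k * (-s - k) := by
      rw [choose_eq_prod_div_factorial, choose_eq_prod_div_factorial, Finset.prod_range_succ,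
        Nat.factorial_succ]
      have h2 : (k.factorial : ℂ) ≠ 0 := by exact_mod_cast k.factorial_ne_zero
      have h3 : (k : ℂ) + 1 ≠ 0 := by exact_mod_cast k.succ_ne_zero
      push_cast
      field_simp
    have h2 : ((R + k + 1 : ℕ) : ℝ) * ((R + k).choose k : ℝ) =
        ((R + k + 1).choose (k + 1) : ℝ) * ((k + 1 : ℕ) : ℝ) := by
      exact_mod_cast Nat.add_one_mul_choose_eq (R + k) k
    have h3 : ‖(k : ℂ) + 1‖ = (k : ℝ) + 1 := by exact_mod_cast Complex.norm_natCast (k + 1)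
    have h4 : ‖-s - k‖ ≤ (R : ℝ) + k + 1 := by
      refine (norm_sub_le _ _).trans ?_
      rw [norm_neg, Complex.norm_natCast]
      linarith
    have h5 := congrArg norm h1
    rw [norm_mul, norm_mul, h3] at h5
    rw [← add_assoc]
    refine le_of_mul_le_mul_right ?_ hk
    rw [h5]
    push_cast at h2
    rw [← h2, mul_comm]
    gcongr

lemma multinomial_le_pow {m : ℕ} (k : Fin m → ℕ) :
    Nat.multinomial Finset.univ k ≤ m ^ ∑ i, k i := by
  have h := Finset.sum_pow_eq_sum_piAntidiag (Finset.univ : Finset (Fin m)) (fun _ => (1 : ℕ))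
    (∑ i, k i)
  simp only [Finset.sum_const, Finset.card_univ, Fintype.card_fin, smul_eq_mul, mul_one, one_pow,
    Finset.prod_const_one, Nat.cast_id] at h
  rw [h]
  exact Finset.single_le_sum (f := fun k : Fin m → ℕ => Nat.multinomial Finset.univ k)
    (fun _ _ => Nat.zero_le _) (by simp [Finset.mem_piAntidiag])

/-- The monomial of multi-index `k` in the expansion of `(1 + ∑ i, x i) ^ z`. -/
noncomputable def binomialMonomial {m : ℕ} (x : Fin m → ℂ) (z : ℂ) (k : Fin m → ℕ) : ℂ :=
  Ring.choose z (∑ i, k i) * (Nat.multinomial Finset.univ k : ℂ) * ∏ i, x i ^ k i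

lemma binomialMonomial_mul {m : ℕ} (x y : Fin m → ℂ) (z : ℂ) (k : Fin m → ℕ) :
    binomialMonomial (fun i => x i * y i) z k = binomialMonomial x z k * ∏ i, y i ^ k i := by
  simp only [binomialMonomial, mul_pow, Finset.prod_mul_distrib, mul_assoc]

lemma norm_binomialMonomial_le {m : ℕ} (x : Fin m → ℂ) {s : ℂ} {R : ℕ} (hs : ‖s‖ ≤ R)
    (k : Fin m → ℕ) :
    ‖binomialMonomial x (-s) k‖ ≤ 2 ^ R * ∏ i, (2 * m * ‖x i‖) ^ k i := by
  set K := ∑ i, k i with hK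
  have h1 : ‖Ring.choose (-s) K‖ ≤ 2 ^ R * 2 ^ K := by
    refine (norm_choose_neg_le hs K).trans ?_
    rw [← pow_add]
    exact_mod_cast Nat.choose_le_two_pow (R + K) K
  have h2 : (Nat.multinomial Finset.univ k : ℝ) ≤ (m : ℝ) ^ K := by
    exact_mod_cast multinomial_le_pow k
  rw [binomialMonomial, norm_mul, norm_mul, Complex.norm_natCast, norm_prod]
  simp only [norm_pow, mul_pow, Finset.prod_mul_distrib, Finset.prod_pow_eq_pow_sum, ← hK]
  calc ‖Ring.choose (-s) K‖ * (Nat.multinomial Finset.univ k : ℝ) * ∏ i, ‖x i‖ ^ k i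
      ≤ (2 ^ R * 2 ^ K) * (m : ℝ) ^ K * ∏ i, ‖x i‖ ^ k i := by
        gcongr
    _ = 2 ^ R * (2 ^ K * (m : ℝ) ^ K * ∏ i, ‖x i‖ ^ k i) := by ring

/-- The binomial series at a sum, expanded by the multinomial theorem. -/
lemma hasSum_binomialMonomial {m : ℕ} {x : Fin m → ℂ} {z : ℂ}
    (hsum : Summable (binomialMonomial x z)) (hx : ‖∑ i, x i‖ < 1) :
    HasSum (binomialMonomial x z) ((1 + ∑ i, x i) ^ z) := by
  have h1 := hsum.hasSum.tsum_fiberwise fun k : Fin m → ℕ => ∑ i, k i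
  have h2 : HasSum (fun n => Ring.choose z n * (∑ i, x i) ^ n) ((1 + ∑ i, x i) ^ z) := by
    have := (Complex.one_add_cpow_hasFPowerSeriesOnBall_zero (a := z)).hasSum
      (y := ∑ i, x i) (by
        rw [Metric.mem_eball, edist_zero_right, ← ofReal_norm]
        exact ENNReal.ofReal_lt_one.2 hx)
    simpa only [binomialSeries_apply, List.ofFn_const, List.prod_replicate, smul_eq_mul, zero_add]
      using this
  have h3 : ∀ n : ℕ, ∑' k : ((fun k : Fin m → ℕ => ∑ i, k i) ⁻¹' {n}), binomialMonomial x z k =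
      Ring.choose z n * (∑ i, x i) ^ n := by
    intro n
    have hset : ((fun k : Fin m → ℕ => ∑ i, k i) ⁻¹' {n}) =
        ((Finset.univ.piAntidiag n : Finset (Fin m → ℕ)) : Set (Fin m → ℕ)) := by
      ext k
      simp [Finset.mem_piAntidiag]
    rw [hset, Finset.tsum_subtype' (Finset.univ.piAntidiag n) (binomialMonomial x z),
      Finset.sum_pow_eq_sum_piAntidiag, Finset.mul_sum]
    refine Finset.sum_congr rfl fun k hk => ?_
    rw [binomialMonomial, (Finset.mem_piAntidiag.1 hk).1, mul_assoc]
  rw [funext h3] at h1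
  rw [← h1.unique h2]
  exact hsum.hasSum

/-! ### Simple poles -/

/-- A function that equals `g s / (s - s₀)` around `s₀` with `g` analytic has at most a simple pole
there, with residue `g s₀`. -/
lemma simple_pole_of_eventuallyEq {f g : ℂ → ℂ} {s₀ : ℂ} (hg : AnalyticAt ℂ g s₀)
    (hfg : ∀ᶠ s in 𝓝[≠] s₀, f s = g s / (s - s₀)) :
    MeromorphicAt f s₀ ∧ -1 ≤ meromorphicOrderAt f s₀ ∧ IsResidueAt f s₀ (g s₀) := by
  have hinv : MeromorphicAt (fun s : ℂ => (s - s₀)⁻¹) s₀ := by fun_prop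
  have hmer : MeromorphicAt (g * fun s : ℂ => (s - s₀)⁻¹) s₀ := hg.meromorphicAt.mul hinv
  have heq : (g * fun s : ℂ => (s - s₀)⁻¹) =ᶠ[𝓝[≠] s₀] f := by
    filter_upwards [hfg] with s hs
    rw [hs, Pi.mul_apply, div_eq_mul_inv]
  refine ⟨hmer.congr heq, ?_, ?_⟩
  · rw [← meromorphicOrderAt_congr heq, meromorphicOrderAt_mul hg.meromorphicAt hinv]
    have h1 : meromorphicOrderAt (fun s : ℂ => (s - s₀)⁻¹) s₀ = (-1 : ℤ) := by
      rw [meromorphicOrderAt_eq_int_iff hinv]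
      exact ⟨fun _ => 1, analyticAt_const, one_ne_zero, by simp⟩
    rw [h1]
    exact le_add_of_nonneg_left hg.meromorphicOrderAt_nonneg
  · rw [eventually_nhdsWithin_iff, Metric.eventually_nhds_iff_ball] at hfg
    obtain ⟨ε, hε, hf⟩ := hfg
    obtain ⟨δ, hδ, hgδ⟩ := Metric.eventually_nhds_iff_ball.1 hg.eventually_analyticAt
    have hpos : ∀ᶠ r in 𝓝[>] (0 : ℝ), r ∈ Set.Ioo (0 : ℝ) (min ε δ) :=
      Ioo_mem_nhdsGT (lt_min hε hδ)
    filter_upwards [hpos] with r hr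
    have hr0 : 0 < r := hr.1
    have hrε : r < ε := hr.2.trans_le (min_le_left _ _)
    have hrδ : r < δ := hr.2.trans_le (min_le_right _ _)
    have hne : ∀ s ∈ Metric.sphere s₀ r, s ≠ s₀ := fun s hs h => by
      rw [h, Metric.mem_sphere, dist_self] at hs
      exact hr0.ne hs
    have hcongr : Set.EqOn f (fun s => (s - s₀)⁻¹ • g s) (Metric.sphere s₀ r) := fun s hs => by
      have h1 : s ∈ Metric.ball s₀ ε := by
        rw [Metric.mem_ball, Metric.mem_sphere.1 hs]; exact hrε
      simp only [smul_eq_mul]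
      rw [hf s h1 (hne s hs), div_eq_mul_inv, mul_comm]
    have hdiff : DifferentiableOn ℂ g (Metric.closedBall s₀ r) := fun s hs =>
      (hgδ s (Metric.closedBall_subset_ball hrδ hs)).differentiableAt.differentiableWithinAt
    constructor
    · rw [circleIntegrable_congr (by rwa [abs_of_pos hr0])]
      refine ContinuousOn.circleIntegrable hr0.le ?_
      refine ContinuousOn.smul (ContinuousOn.inv₀ (f := fun s => s - s₀) (by fun_prop) fun s hs => ?_)
        (hdiff.continuousOn.mono Metric.sphere_subset_closedBall)
      exact sub_ne_zero.2 (hne s hs)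
    · rw [circleIntegral.integral_congr hr0.le hcongr]
      have hcl : DiffContOnCl ℂ g (Metric.ball s₀ r) :=
        DifferentiableOn.diffContOnCl (by rwa [closure_ball s₀ hr0.ne'])
      rw [hcl.circleIntegral_sub_inv_smul (Metric.mem_ball_self hr0), smul_eq_mul]
      exact inv_mul_cancel_left₀ (by simp [Real.pi_ne_zero]) _

/-- The quotient `A / (1 - q)` at a simple zero of `1 - q`. -/
lemma exists_numerator_of_simple_zero {A q : ℂ → ℂ} {s₀ d : ℂ} (hA : AnalyticAt ℂ A s₀)
    (hq : Differentiable ℂ q) (hq1 : q s₀ = 1) (hd : HasDerivAt q (-d) s₀) (hd0 : d ≠ 0) :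
    ∃ g : ℂ → ℂ, AnalyticAt ℂ g s₀ ∧ g s₀ = A s₀ / d ∧
      ∀ᶠ s in 𝓝[≠] s₀, A s / (1 - q s) = g s / (s - s₀) := by
  set D := dslope (fun s => 1 - q s) s₀ with hD
  have hDan : AnalyticAt ℂ D s₀ := by
    have h1 : DifferentiableOn ℂ D Set.univ :=
      (Complex.differentiableOn_dslope univ_mem).2 (by fun_prop)
    exact h1.analyticAt univ_mem
  have hD0 : D s₀ = d := by
    rw [hD, dslope_same]
    have := (hd.const_sub 1).deriv
    simpa using this
  refine ⟨fun s => A s / D s, hA.div hDan (by rwa [hD0]), by simp only [hD0], ?_⟩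
  rw [eventually_nhdsWithin_iff]
  filter_upwards with s hs
  have hne : s - s₀ ≠ 0 := sub_ne_zero.2 hs
  have h1 : 1 - q s = D s * (s - s₀) := by
    have := sub_smul_dslope (fun s => 1 - q s) s₀ s
    simp only [hq1, sub_self, sub_zero, smul_eq_mul] at this
    rw [← this, mul_comm]
  rw [h1, div_div]

/-! ### Multi-index expansion for sequences with a dominant root -/

section DominatedSequence

variable {m : ℕ} {α : ℝ} {β : Fin m → ℂ}

/-- The ratio `α ^ (-s) * ∏ i, (β i / α) ^ k i` of the geometric series that belongs to the
multi-index `k`, written so that it visibly equals `1` exactly at the points `polePoint α β k n`. -/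
noncomputable def poleRatio (α : ℝ) (β : Fin m → ℂ) (k : Fin m → ℕ) (s : ℂ) : ℂ :=
  Complex.exp (-(s - polePoint α β k 0) * (Real.log α : ℂ))

lemma polePoint_eq (k : Fin m → ℕ) (n : ℤ) :
    polePoint α β k n = polePoint α β k 0 +
      2 * (n : ℂ) * (Real.pi : ℂ) * Complex.I / (Real.log α : ℂ) := by
  simp only [polePoint, Int.cast_zero]
  ring

lemma poleRatio_eq_one_iff (hα : 1 < α) {k : Fin m → ℕ} {s : ℂ} :
    poleRatio α β k s = 1 ↔ ∃ n : ℤ, s = polePoint α β k n := by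
  have hL : (Real.log α : ℂ) ≠ 0 := by exact_mod_cast (Real.log_pos hα).ne'
  rw [poleRatio, Complex.exp_eq_one_iff]
  constructor
  · rintro ⟨n, hn⟩
    refine ⟨-n, ?_⟩
    rw [polePoint_eq]
    field_simp
    push_cast
    linear_combination -hn
  · rintro ⟨n, rfl⟩
    refine ⟨-n, ?_⟩
    rw [polePoint_eq]
    field_simp
    push_cast
    ring

lemma poleRatio_eq (hα : 1 < α) (hβ : ∀ i, β i ≠ 0) (k : Fin m → ℕ) (s : ℂ) :
    poleRatio α β k s =
      Complex.exp (-s * (Real.log α : ℂ)) * ∏ i, (β i / (α : ℂ)) ^ k i := by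
  have hL : (Real.log α : ℂ) ≠ 0 := by exact_mod_cast (Real.log_pos hα).ne'
  have h0 : (α : ℂ) = Complex.exp (Real.log α : ℂ) := by
    rw [← Complex.ofReal_exp, Real.exp_log (by linarith)]
  have h1 : ∀ i, (β i / (α : ℂ)) ^ k i =
      Complex.exp ((k i : ℂ) * (Complex.log (β i) - (Real.log α : ℂ))) := fun i => by
    rw [Complex.exp_nat_mul, Complex.exp_sub, Complex.exp_log (hβ i), ← h0]
  simp only [h1]
  rw [← Complex.exp_sum, ← Complex.exp_add, poleRatio, polePoint]
  congr 1
  simp only [mul_sub, Finset.sum_sub_distrib, ← Finset.sum_mul]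
  push_cast
  field_simp
  ring

lemma norm_poleRatio (hα : 1 < α) (hβ : ∀ i, β i ≠ 0) (k : Fin m → ℕ) (s : ℂ) :
    ‖poleRatio α β k s‖ = Real.exp (-s.re * Real.log α) * ∏ i, (‖β i‖ / α) ^ k i := by
  rw [poleRatio_eq hα hβ, norm_mul, Complex.norm_exp, norm_prod]
  congr 1
  · simp [Complex.mul_re, Complex.ofReal_re, Complex.ofReal_im]
  · refine Finset.prod_congr rfl fun i _ => ?_
    rw [norm_pow, norm_div, Complex.norm_real, Real.norm_of_nonneg (by linarith)]

lemma norm_div_lt_one (hα : 1 < α) (hβ1 : ∀ i, ‖β i‖ < 1) (i : Fin m) : ‖β i‖ / α < 1 := by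
  rw [div_lt_one (by linarith)]
  exact (hβ1 i).trans hα

lemma exp_neg_re_mul_log_le (hα : 1 < α) {s : ℂ} {R : ℕ} (hs : ‖s‖ ≤ R) :
    Real.exp (-s.re * Real.log α) ≤ Real.exp (R * Real.log α) := by
  refine Real.exp_le_exp.2 (mul_le_mul_of_nonneg_right ?_ (Real.log_pos hα).le)
  have h1 := (abs_le.1 (Complex.abs_re_le_norm s)).1
  linarith

/-- On a disc, all but finitely many ratios are at most `1 / 2` in modulus. -/
lemma eventually_norm_poleRatio_le (hα : 1 < α) (hβ : ∀ i, β i ≠ 0) (hβ1 : ∀ i, ‖β i‖ < 1)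
    (R : ℕ) : ∀ᶠ k in cofinite, ∀ s : ℂ, ‖s‖ ≤ R → ‖poleRatio α β k s‖ ≤ 1 / 2 := by
  have h1 : Summable fun k : Fin m → ℕ => ∏ i, (‖β i‖ / α) ^ k i :=
    summable_prod_pow (fun i => by positivity) (norm_div_lt_one hα hβ1)
  have h2 := (h1.mul_left (Real.exp (R * Real.log α))).tendsto_cofinite_zero
  have h3 := h2.eventually_le_const (show (0 : ℝ) < 1 / 2 by norm_num)
  filter_upwards [h3] with k hk s hs
  rw [norm_poleRatio hα hβ]
  refine le_trans (mul_le_mul_of_nonneg_right (exp_neg_re_mul_log_le hα hs) ?_) hk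
  exact Finset.prod_nonneg fun i _ => by positivity

/-- The contribution of the multi-index `k` to the sum over `n ≥ N`: a binomial coefficient times
the tail of a geometric series. -/
noncomputable def poleTerm (α : ℝ) (β κ : Fin m → ℂ) (N : ℕ) (s : ℂ) (k : Fin m → ℕ) : ℂ :=
  binomialMonomial κ (-s) k * poleRatio α β k s ^ N / (1 - poleRatio α β k s)

lemma norm_binomialMonomial_mul_poleRatio_pow_le (hα : 1 < α) (hβ : ∀ i, β i ≠ 0)
    {κ : Fin m → ℂ} {N : ℕ} (hN : ∀ i, 4 * m * ‖κ i‖ * (‖β i‖ / α) ^ N ≤ 1) {s : ℂ} {R : ℕ}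
    (hs : ‖s‖ ≤ R) (k : Fin m → ℕ) :
    ‖binomialMonomial κ (-s) k * poleRatio α β k s ^ N‖ ≤
      2 ^ R * Real.exp (R * Real.log α) ^ N * ∏ i : Fin m, (1 / 2 : ℝ) ^ k i := by
  have h1 := norm_binomialMonomial_le κ hs k
  have h2 := exp_neg_re_mul_log_le hα hs
  rw [norm_mul, norm_pow, norm_poleRatio hα hβ, mul_pow, ← Finset.prod_pow]
  calc ‖binomialMonomial κ (-s) k‖ *
        (Real.exp (-s.re * Real.log α) ^ N * ∏ i, ((‖β i‖ / α) ^ k i) ^ N)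
      ≤ (2 ^ R * ∏ i, (2 * m * ‖κ i‖) ^ k i) *
        (Real.exp (R * Real.log α) ^ N * ∏ i, ((‖β i‖ / α) ^ k i) ^ N) := by
        gcongr
    _ = 2 ^ R * Real.exp (R * Real.log α) ^ N *
        ∏ i, (2 * m * ‖κ i‖ * (‖β i‖ / α) ^ N) ^ k i := by
        simp only [mul_pow (_ : ℝ) ((_ : ℝ) ^ N), Finset.prod_mul_distrib, ← pow_mul, mul_comm N]
        ring
    _ ≤ _ := by
        gcongr with i
        linarith [hN i]

lemma differentiable_poleRatio (k : Fin m → ℕ) : Differentiable ℂ (poleRatio α β k) := by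
  unfold poleRatio
  fun_prop

lemma differentiable_binomialMonomial_neg (κ : Fin m → ℂ) (k : Fin m → ℕ) :
    Differentiable ℂ fun s => binomialMonomial κ (-s) k := by
  simp only [binomialMonomial, choose_eq_prod_div_factorial]
  fun_prop

lemma analyticAt_poleTerm (κ : Fin m → ℂ) (N : ℕ) {k : Fin m → ℕ} {s : ℂ}
    (h : poleRatio α β k s ≠ 1) : AnalyticAt ℂ (fun s => poleTerm α β κ N s k) s := by
  have h1 := (differentiable_poleRatio (α := α) (β := β) k).analyticAt s
  exact (((differentiable_binomialMonomial_neg κ k).analyticAt s).mul (h1.pow N)).div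
    (analyticAt_const.sub h1) (sub_ne_zero.2 h.symm)

lemma summable_half_pow : Summable fun k : Fin m → ℕ => ∏ i : Fin m, (1 / 2 : ℝ) ^ k i :=
  summable_prod_pow (fun _ => by norm_num) fun _ => by norm_num

lemma norm_poleTerm_le (hα : 1 < α) (hβ : ∀ i, β i ≠ 0)
    {κ : Fin m → ℂ} {N : ℕ} (hN : ∀ i, 4 * m * ‖κ i‖ * (‖β i‖ / α) ^ N ≤ 1) {s : ℂ} {R : ℕ}
    (hs : ‖s‖ ≤ R) {k : Fin m → ℕ} (hk : ‖poleRatio α β k s‖ ≤ 1 / 2) :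
    ‖poleTerm α β κ N s k‖ ≤
      2 * (2 ^ R * Real.exp (R * Real.log α) ^ N) * ∏ i : Fin m, (1 / 2 : ℝ) ^ k i := by
  have h1 := norm_binomialMonomial_mul_poleRatio_pow_le hα hβ hN hs k
  have h2 : 1 / 2 ≤ ‖1 - poleRatio α β k s‖ := by
    have := norm_sub_norm_le 1 (poleRatio α β k s)
    rw [norm_one] at this
    linarith
  rw [poleTerm, norm_div, div_le_iff₀ (by linarith)]
  refine h1.trans ?_
  have h3 : 0 ≤ 2 ^ R * Real.exp (R * Real.log α) ^ N * ∏ i : Fin m, (1 / 2 : ℝ) ^ k i :=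
    (norm_nonneg _).trans h1
  nlinarith

/-- Around a point where the ratios other than that of `k₀` differ from `1`, the sum of all terms is
analytic up to the term of `k₀`. -/
lemma exists_analyticAt_tsum_poleTerm (hα : 1 < α) (hβ : ∀ i, β i ≠ 0) (hβ1 : ∀ i, ‖β i‖ < 1)
    {κ : Fin m → ℂ} {N : ℕ} (hN : ∀ i, 4 * m * ‖κ i‖ * (‖β i‖ / α) ^ N ≤ 1) {s₀ : ℂ}
    (k₀ : Fin m → ℕ) (hk₀ : ∀ k, k ≠ k₀ → poleRatio α β k s₀ ≠ 1) :
    ∃ H : ℂ → ℂ, AnalyticAt ℂ H s₀ ∧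
      ∀ᶠ s in 𝓝 s₀, ∑' k, poleTerm α β κ N s k = poleTerm α β κ N s k₀ + H s := by
  classical
  obtain ⟨R, hR⟩ := exists_nat_ge (‖s₀‖ + 1)
  have hball : ∀ s ∈ Metric.ball s₀ 1, ‖s‖ ≤ R := fun s hs => by
    have h1 : ‖s - s₀‖ < 1 := by simpa [dist_eq_norm] using hs
    have h2 : ‖s‖ ≤ ‖s - s₀‖ + ‖s₀‖ := by simpa using norm_add_le (s - s₀) s₀
    linarith
  set T : Finset (Fin m → ℕ) :=
    insert k₀ (eventually_cofinite.1 (eventually_norm_poleRatio_le hα hβ hβ1 R)).toFinset with hT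
  have hT' : ∀ k : ((T : Set (Fin m → ℕ))ᶜ : Set (Fin m → ℕ)), ∀ s ∈ Metric.ball s₀ 1,
      ‖poleRatio α β k s‖ ≤ 1 / 2 := by
    rintro ⟨k, hk⟩ s hs
    by_contra hcon
    refine hk (Finset.mem_coe.2 (Finset.mem_insert_of_mem ((Set.Finite.mem_toFinset _).2 ?_)))
    exact fun h => hcon (h s (hball s hs))
  set u : ((T : Set (Fin m → ℕ))ᶜ : Set (Fin m → ℕ)) → ℝ := fun k =>
    2 * (2 ^ R * Real.exp (R * Real.log α) ^ N) * ∏ i : Fin m, (1 / 2 : ℝ) ^ k.1 i with hu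
  have husum : Summable u := (summable_half_pow.mul_left _).subtype _
  have hle : ∀ (k : ((T : Set (Fin m → ℕ))ᶜ : Set (Fin m → ℕ))) (s : ℂ), s ∈ Metric.ball s₀ 1 →
      ‖poleTerm α β κ N s k‖ ≤ u k := fun k s hs =>
    norm_poleTerm_le hα hβ hN (hball s hs) (hT' k s hs)
  have hdiff : DifferentiableOn ℂ
      (fun s => ∑' k : ((T : Set (Fin m → ℕ))ᶜ : Set (Fin m → ℕ)), poleTerm α β κ N s k)
      (Metric.ball s₀ 1) := by
    refine Complex.differentiableOn_tsum_of_summable_norm husum (fun k s hs => ?_)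
      Metric.isOpen_ball hle
    refine (analyticAt_poleTerm κ N fun h => ?_).differentiableAt.differentiableWithinAt
    have := hT' k s hs
    rw [h, norm_one] at this
    norm_num at this
  refine ⟨fun s => (∑ k ∈ T.erase k₀, poleTerm α β κ N s k) +
    ∑' k : ((T : Set (Fin m → ℕ))ᶜ : Set (Fin m → ℕ)), poleTerm α β κ N s k, ?_, ?_⟩
  · refine AnalyticAt.add ?_ (hdiff.analyticAt (Metric.ball_mem_nhds s₀ one_pos))
    exact Finset.analyticAt_fun_sum _ fun k hk =>
      analyticAt_poleTerm κ N (hk₀ k (Finset.ne_of_mem_erase hk))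
  · filter_upwards [Metric.ball_mem_nhds s₀ one_pos] with s hs
    have hsum : Summable fun k => poleTerm α β κ N s k :=
      (Finset.summable_compl_iff T).1 (Summable.of_norm_bounded husum fun k => hle k s hs)
    rw [← hsum.sum_add_tsum_compl (s := T), ← add_assoc,
      Finset.add_sum_erase T (fun k => poleTerm α β κ N s k) (Finset.mem_insert_self _ _)]

/-- In the half-plane of convergence, summing over `n` first gives the geometric series, and summing
over the multi-indices first gives the binomial series. -/
lemma hasSum_tsum_poleTerm (hα : 1 < α) (hβ : ∀ i, β i ≠ 0) (hβ1 : ∀ i, ‖β i‖ < 1)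
    {κ : Fin m → ℂ} {N : ℕ} (hN : ∀ i, 4 * m * ‖κ i‖ * (‖β i‖ / α) ^ N ≤ 1) {s : ℂ}
    (hs : 0 < s.re) :
    HasSum (fun n : ℕ => Complex.exp (-s * (Real.log α : ℂ)) ^ (n + N) *
      (1 + ∑ i, κ i * (β i / (α : ℂ)) ^ (n + N)) ^ (-s)) (∑' k, poleTerm α β κ N s k) := by
  obtain ⟨R, hR⟩ := exists_nat_ge ‖s‖
  set C := 2 ^ R * Real.exp (R * Real.log α) ^ N with hC
  set θ := Real.exp (-s.re * Real.log α) with hθ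
  have hθ1 : θ < 1 := by
    rw [hθ, Real.exp_lt_one_iff, neg_mul, neg_lt_zero]
    exact mul_pos hs (Real.log_pos hα)
  have hq : ∀ k, ‖poleRatio α β k s‖ ≤ θ := fun k => by
    rw [norm_poleRatio hα hβ]
    refine mul_le_of_le_one_right (Real.exp_pos _).le (Finset.prod_le_one
      (fun i _ => by positivity) fun i _ => pow_le_one₀ (by positivity)
        (norm_div_lt_one hα hβ1 i).le)
  set G : ℕ × (Fin m → ℕ) → ℂ := fun p =>
    binomialMonomial κ (-s) p.2 * poleRatio α β p.2 s ^ (p.1 + N) with hG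
  have hGle : ∀ p, ‖G p‖ ≤ θ ^ p.1 * (C * ∏ i : Fin m, (1 / 2 : ℝ) ^ p.2 i) := fun p => by
    have h1 := norm_binomialMonomial_mul_poleRatio_pow_le hα hβ hN hR p.2
    have h2 : G p = poleRatio α β p.2 s ^ p.1 *
        (binomialMonomial κ (-s) p.2 * poleRatio α β p.2 s ^ N) := by
      simp only [hG, pow_add]; ring
    rw [h2, norm_mul, norm_pow]
    gcongr
    exact hq p.2
  have hGsum : Summable G := by
    refine Summable.of_norm_bounded (Summable.mul_of_nonneg
      (summable_geometric_of_lt_one (Real.exp_pos _).le hθ1)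
      (summable_half_pow.mul_left C) (fun n => by positivity) (fun k => ?_)) hGle
    have : 0 ≤ ∏ i : Fin m, (1 / 2 : ℝ) ^ k i := Finset.prod_nonneg fun i _ => by positivity
    positivity
  have hcol : ∀ k, HasSum (fun n => G (n, k)) (poleTerm α β κ N s k) := fun k => by
    have h1 := (hasSum_geometric_of_norm_lt_one ((hq k).trans_lt hθ1)).mul_left
      (binomialMonomial κ (-s) k * poleRatio α β k s ^ N)
    rw [← div_eq_mul_inv] at h1
    refine h1.congr_fun fun n => ?_
    simp only [hG, pow_add]
    ring
  have hrow : ∀ n, HasSum (fun k => G (n, k)) (Complex.exp (-s * (Real.log α : ℂ)) ^ (n + N) *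
      (1 + ∑ i, κ i * (β i / (α : ℂ)) ^ (n + N)) ^ (-s)) := fun n => by
    set E := Complex.exp (-s * (Real.log α : ℂ)) ^ (n + N) with hE
    have hE0 : E ≠ 0 := pow_ne_zero _ (Complex.exp_ne_zero _)
    have h1 : ∀ k, G (n, k) = E *
        binomialMonomial (fun i => κ i * (β i / (α : ℂ)) ^ (n + N)) (-s) k := fun k => by
      rw [binomialMonomial_mul]
      simp only [hG, poleRatio_eq hα hβ, mul_pow, ← Finset.prod_pow, ← pow_mul,
        mul_comm (k _) (n + N)]
      ring
    have h2 : Summable (binomialMonomial (fun i => κ i * (β i / (α : ℂ)) ^ (n + N)) (-s)) := by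
      have h3 := hGsum.comp_injective (Prod.mk_right_injective n)
      have h4 := h3.mul_left E⁻¹
      refine h4.congr fun k => ?_
      simp only [Function.comp_apply, h1]
      rw [inv_mul_cancel_left₀ hE0]
    have h5 : ‖∑ i, κ i * (β i / (α : ℂ)) ^ (n + N)‖ < 1 := by
      have h6 : ∀ i, (m : ℝ) * ‖κ i * (β i / (α : ℂ)) ^ (n + N)‖ ≤ 1 / 4 := fun i => by
        have h7 : ‖β i / (α : ℂ)‖ = ‖β i‖ / α := by
          rw [norm_div, Complex.norm_real, Real.norm_of_nonneg (by linarith)]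
        rw [norm_mul, norm_pow, h7]
        have h8 : (‖β i‖ / α) ^ (n + N) ≤ (‖β i‖ / α) ^ N :=
          pow_le_pow_of_le_one (by positivity) (norm_div_lt_one hα hβ1 i).le (by omega)
        have h9 : (m : ℝ) * (‖κ i‖ * (‖β i‖ / α) ^ (n + N)) ≤
            m * (‖κ i‖ * (‖β i‖ / α) ^ N) := by gcongr
        have := hN i
        linarith
      rcases Nat.eq_zero_or_pos m with rfl | hm
      · simp
      · have hm' : (0 : ℝ) < m := by exact_mod_cast hm
        calc ‖∑ i, κ i * (β i / (α : ℂ)) ^ (n + N)‖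
            ≤ ∑ i : Fin m, 1 / 4 / (m : ℝ) := by
              refine (norm_sum_le _ _).trans (Finset.sum_le_sum fun i _ => ?_)
              rw [le_div_iff₀ hm', mul_comm]
              exact h6 i
          _ = 1 / 4 := by
              rw [Finset.sum_const, Finset.card_univ, Fintype.card_fin, nsmul_eq_mul]
              field_simp
          _ < 1 := by norm_num
    exact ((hasSum_binomialMonomial h2 h5).mul_left E).congr_fun h1
  have hcols : HasSum (fun k => poleTerm α β κ N s k) (∑' p, G p) :=
    ((Equiv.prodComm _ _).hasSum_iff.2 hGsum.hasSum).prod_fiberwise hcol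
  rw [hcols.tsum_eq]
  exact hGsum.hasSum.prod_fiberwise hrow

end DominatedSequence

/-! ### Meromorphic continuation and residues -/

section DominatedSequence

variable {m : ℕ} {α : ℝ} {β : Fin m → ℂ}

lemma cpow_neg_of_eq_sum (hα : 1 < α) {w x : ℝ} (hw : 0 < w) (hx : 0 < x) {c : Fin m → ℂ} {n : ℕ}
    (h : (x : ℂ) = w * (α : ℂ) ^ n + ∑ i, c i * β i ^ n) (s : ℂ) :
    (x : ℂ) ^ (-s) = (w : ℂ) ^ (-s) * (Complex.exp (-s * (Real.log α : ℂ)) ^ n *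
      (1 + ∑ i, c i / w * (β i / (α : ℂ)) ^ n) ^ (-s)) := by
  have hα0 : 0 < α := by linarith
  have hwC : (w : ℂ) ≠ 0 := by exact_mod_cast hw.ne'
  have hαC : (α : ℂ) ≠ 0 := by exact_mod_cast hα0.ne'
  have hpow : 0 < α ^ n := pow_pos hα0 n
  have h1 : 1 + ∑ i, c i / w * (β i / (α : ℂ)) ^ n = ((x / (w * α ^ n) : ℝ) : ℂ) := by
    push_cast
    rw [h, add_div, div_self (mul_ne_zero hwC (pow_ne_zero n hαC)), Finset.sum_div]
    congr 1
    refine Finset.sum_congr rfl fun i _ => ?_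
    rw [div_pow, div_mul_div_comm]
  have h2 : (x : ℂ) = (w : ℂ) * ((α ^ n * (x / (w * α ^ n)) : ℝ) : ℂ) := by
    rw [← Complex.ofReal_mul]
    congr 1
    field_simp
  have h3 : ((α ^ n : ℝ) : ℂ) ^ (-s) = Complex.exp (-s * (Real.log α : ℂ)) ^ n := by
    rw [Complex.cpow_def_of_ne_zero (by exact_mod_cast hpow.ne'), ← Complex.ofReal_log hpow.le,
      Real.log_pow, ← Complex.exp_nat_mul]
    congr 1
    push_cast
    ring
  rw [h1, ← h3]
  conv_lhs => rw [h2]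
  rw [Complex.mul_cpow_ofReal_nonneg hw.le (by positivity), Complex.ofReal_mul,
    Complex.mul_cpow_ofReal_nonneg hpow.le (by positivity)]

/-- Meromorphic continuation of `∑ F n ^ (-s)`, where `F n = w α ^ n + ∑ i, c i * β i ^ n` with all
`β i` in the open unit disc, when different multi-indices give different poles. -/
theorem exists_meromorphic_continuation (hα : 1 < α) (hβ : ∀ i, β i ≠ 0) (hβ1 : ∀ i, ‖β i‖ < 1)
    {w : ℝ} (hw : 0 < w) (c : Fin m → ℂ) {F : ℕ → ℝ} (hF : ∀ n, 0 < F (n + 1))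
    (hFsum : ∀ n, (F n : ℂ) = w * (α : ℂ) ^ n + ∑ i, c i * β i ^ n)
    (hinj : ∀ (k k' : Fin m → ℕ) (n n' : ℤ), polePoint α β k n = polePoint α β k' n' → k = k') :
    ∃ ζ : ℂ → ℂ,
      (∀ s : ℂ, 0 < s.re → HasSum (fun n : ℕ => (F (n + 1) : ℂ) ^ (-s)) (ζ s)) ∧
      Meromorphic ζ ∧
      (∀ s : ℂ, (∀ (k : Fin m → ℕ) (n : ℤ), s ≠ polePoint α β k n) → AnalyticAt ℂ ζ s) ∧
      (∀ (k : Fin m → ℕ) (n : ℤ),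
        -1 ≤ meromorphicOrderAt ζ (polePoint α β k n) ∧
        IsResidueAt ζ (polePoint α β k n)
          ((w : ℂ) ^ (-polePoint α β k n) *
            binomialMonomial (fun i => c i / w) (-polePoint α β k n) k / (Real.log α : ℂ))) := by
  set κ : Fin m → ℂ := fun i => c i / w with hκ
  -- Beyond some `N ≥ 1` the non-dominant part is small enough for the multi-index expansion.
  obtain ⟨M, hN⟩ : ∃ M : ℕ, ∀ i, 4 * m * ‖κ i‖ * (‖β i‖ / α) ^ (M + 1) ≤ 1 := by
    have h1 : ∀ i, ∀ᶠ n : ℕ in atTop, 4 * m * ‖κ i‖ * (‖β i‖ / α) ^ (n + 1) ≤ 1 := fun i => by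
      have h2 := ((tendsto_pow_atTop_nhds_zero_of_lt_one (by positivity)
        (norm_div_lt_one hα hβ1 i)).comp (tendsto_add_atTop_nat 1)).const_mul (4 * m * ‖κ i‖)
      rw [mul_zero] at h2
      exact h2.eventually_le_const one_pos
    exact (eventually_all.2 h1).exists
  set ζ : ℂ → ℂ := fun s => (w : ℂ) ^ (-s) * (∑' k, poleTerm α β κ (M + 1) s k) +
    ∑ n ∈ Finset.range M, (F (n + 1) : ℂ) ^ (-s) with hζ
  have hcpow : ∀ x : ℝ, 0 < x → Differentiable ℂ fun s : ℂ => (x : ℂ) ^ (-s) := fun x hx s => by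
    have hx' : (x : ℂ) ≠ 0 := by exact_mod_cast hx.ne'
    exact differentiableAt_id.neg.const_cpow (Or.inl hx')
  have hlocal : ∀ (s₀ : ℂ) (k₀ : Fin m → ℕ), (∀ k, k ≠ k₀ → poleRatio α β k s₀ ≠ 1) →
      ∃ H : ℂ → ℂ, AnalyticAt ℂ H s₀ ∧
        ∀ᶠ s in 𝓝 s₀, ζ s = (w : ℂ) ^ (-s) * poleTerm α β κ (M + 1) s k₀ + H s := by
    intro s₀ k₀ hk₀
    obtain ⟨H, hH, heq⟩ := exists_analyticAt_tsum_poleTerm hα hβ hβ1 hN k₀ hk₀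
    refine ⟨fun s => (w : ℂ) ^ (-s) * H s + ∑ n ∈ Finset.range M, (F (n + 1) : ℂ) ^ (-s),
      (((hcpow w hw).analyticAt s₀).mul hH).add
        (Finset.analyticAt_fun_sum _ fun n _ => (hcpow _ (hF n)).analyticAt s₀), ?_⟩
    filter_upwards [heq] with s hs
    simp only [hζ, hs]
    ring
  have hanalytic : ∀ s : ℂ, (∀ (k : Fin m → ℕ) (n : ℤ), s ≠ polePoint α β k n) →
      AnalyticAt ℂ ζ s := by
    intro s hs
    have hne : ∀ k, poleRatio α β k s ≠ 1 := fun k h => by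
      obtain ⟨n, hn⟩ := (poleRatio_eq_one_iff hα).1 h
      exact hs k n hn
    obtain ⟨H, hH, heq⟩ := hlocal s 0 fun k _ => hne k
    exact ((((hcpow w hw).analyticAt s).mul (analyticAt_poleTerm κ (M + 1) (hne 0))).add hH).congr
      (heq.mono fun _ h => h.symm)
  have hpole : ∀ (k : Fin m → ℕ) (n : ℤ), MeromorphicAt ζ (polePoint α β k n) ∧
      -1 ≤ meromorphicOrderAt ζ (polePoint α β k n) ∧
      IsResidueAt ζ (polePoint α β k n)
        ((w : ℂ) ^ (-polePoint α β k n) *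
          binomialMonomial κ (-polePoint α β k n) k / (Real.log α : ℂ)) := by
    intro k n
    set s₀ := polePoint α β k n with hs₀
    have hq1 : poleRatio α β k s₀ = 1 := (poleRatio_eq_one_iff hα).2 ⟨n, rfl⟩
    obtain ⟨H, hH, heq⟩ := hlocal s₀ k fun k' hk' h => by
      obtain ⟨n', hn'⟩ := (poleRatio_eq_one_iff hα).1 h
      exact hk' (hinj k k' n n' hn').symm
    have hd : HasDerivAt (poleRatio α β k) (-(Real.log α : ℂ)) s₀ := by
      have h1 : HasDerivAt (fun s : ℂ => -(s - polePoint α β k 0) * (Real.log α : ℂ))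
          (-1 * (Real.log α : ℂ)) s₀ :=
        (((hasDerivAt_id s₀).sub_const _).neg).mul_const _
      have h2 := h1.cexp
      have h3 : Complex.exp (-(s₀ - polePoint α β k 0) * (Real.log α : ℂ)) = 1 := hq1
      rw [h3, one_mul, neg_one_mul] at h2
      exact h2
    obtain ⟨g, hg, hg0, hgeq⟩ := exists_numerator_of_simple_zero
      (A := fun s => (w : ℂ) ^ (-s) * (binomialMonomial κ (-s) k * poleRatio α β k s ^ (M + 1)))
      (((hcpow w hw).analyticAt s₀).mul
        (((differentiable_binomialMonomial_neg κ k).analyticAt s₀).mul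
          (((differentiable_poleRatio k).analyticAt s₀).pow _)))
      (differentiable_poleRatio k) hq1 hd (by exact_mod_cast (Real.log_pos hα).ne')
    have hres := simple_pole_of_eventuallyEq (f := ζ) (g := fun s => g s + (s - s₀) * H s)
      (hg.add ((analyticAt_id.sub analyticAt_const).mul hH)) (by
        filter_upwards [hgeq, heq.filter_mono nhdsWithin_le_nhds, self_mem_nhdsWithin]
          with s h1 h2 h3
        have h4 : s - s₀ ≠ 0 := sub_ne_zero.2 h3
        rw [h2, add_div, ← h1, mul_div_cancel_left₀ _ h4, poleTerm, ← mul_div_assoc])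
    have hval : g s₀ + (s₀ - s₀) * H s₀ =
        (w : ℂ) ^ (-s₀) * binomialMonomial κ (-s₀) k / (Real.log α : ℂ) := by
      rw [sub_self, zero_mul, add_zero, hg0]
      simp only [hq1, one_pow, mul_one]
    rw [hval] at hres
    exact hres
  refine ⟨ζ, fun s hs => ?_, fun s => ?_, hanalytic, fun k n => (hpole k n).2⟩
  · refine (hasSum_nat_add_iff M).1 ?_
    refine ((hasSum_tsum_poleTerm hα hβ hβ1 hN hs).mul_left ((w : ℂ) ^ (-s))).congr_fun fun n => ?_
    exact cpow_neg_of_eq_sum hα hw (hF (n + M)) (hFsum (n + M + 1)) s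
  · by_cases h : ∃ (k : Fin m → ℕ) (n : ℤ), s = polePoint α β k n
    · obtain ⟨k, n, rfl⟩ := h
      exact (hpole k n).1
    · push Not at h
      exact (hanalytic s h).meromorphicAt

lemma exp_polePoint_mul_log (hα : 1 < α) (hβ : ∀ i, β i ≠ 0) (k : Fin m → ℕ) (n : ℤ) :
    Complex.exp (polePoint α β k n * (Real.log α : ℂ)) * (α : ℂ) ^ (∑ i, k i) =
      ∏ i, β i ^ k i := by
  have hαC : (α : ℂ) ≠ 0 := by exact_mod_cast (by linarith : α ≠ 0)
  have h1 : poleRatio α β k (polePoint α β k n) = 1 := (poleRatio_eq_one_iff hα).2 ⟨n, rfl⟩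
  rw [poleRatio_eq hα hβ, neg_mul, Complex.exp_neg] at h1
  simp only [div_pow, Finset.prod_div_distrib, Finset.prod_pow_eq_pow_sum] at h1
  have h2 := Complex.exp_ne_zero (polePoint α β k n * (Real.log α : ℂ))
  have h3 : (α : ℂ) ^ (∑ i, k i) ≠ 0 := pow_ne_zero _ hαC
  field_simp at h1
  exact h1.symm

end DominatedSequence

/-- The roots, indexed with the dominant one at `none`. -/
lemma roots_eq_map_option {ℓ m : ℕ} {a : ℂ} {β : Fin m → ℂ}
    (hroots : (fibPoly ℓ).roots = a ::ₘ Finset.univ.val.map β) :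
    (fibPoly ℓ).roots = Finset.univ.val.map fun o : Option (Fin m) => o.elim a β := by
  rw [hroots, univ_option]
  change _ = Multiset.map _ (none ::ₘ Finset.univ.val.map some)
  rw [Multiset.map_cons, Multiset.map_map]
  rfl

/-- Different multi-indices give different points: a coincidence would be a multiplicative relation
between the roots, with exponent difference `∑ k' - ∑ k` at the dominant root and `k i - k' i` at
the others. -/
lemma polePoint_injective {ℓ : ℕ} (hℓ : 2 ≤ ℓ) {α : ℝ} (hα : 1 < α) {β : Fin (ℓ - 1) → ℂ}
    (hroots : (fibPoly ℓ).roots = (α : ℂ) ::ₘ Finset.univ.val.map β)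
    (k k' : Fin (ℓ - 1) → ℕ) (n n' : ℤ) (h : polePoint α β k n = polePoint α β k' n') :
    k = k' := by
  set r : Option (Fin (ℓ - 1)) → ℂ := fun o => o.elim (α : ℂ) β with hr
  have hr' : (fibPoly ℓ).roots = Finset.univ.val.map r := roots_eq_map_option hroots
  have hαr : (fibPoly ℓ).eval (α : ℂ) = 0 := eval_fibPoly_root hr' none
  have hβ : ∀ i, β i ≠ 0 := fun i => fibPoly_root_ne_zero hℓ (eval_fibPoly_root hr' (some i))
  have h1 := exp_polePoint_mul_log hα hβ k n
  have h2 := exp_polePoint_mul_log hα hβ k' n'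
  rw [← h] at h2
  have h3 : ∏ o, r o ^ (o.elim (∑ i, k' i) k : ℕ) = ∏ o, r o ^ (o.elim (∑ i, k i) k' : ℕ) := by
    simp only [Fintype.prod_option, hr, Option.elim]
    rw [← h1, ← h2]
    ring
  have h4 : ∀ i, (k i : ℤ) - k' i = (∑ i, k' i : ℕ) - (∑ i, k i : ℕ) := fun i => by
    have := exponents_of_monomial_eq hℓ hα hαr hr' h3 (some i) none
    simpa using this
  have h5 : (∑ i, (k i : ℤ)) - ∑ i, (k' i : ℤ) =
      (ℓ - 1 : ℕ) * ((∑ i, k' i : ℕ) - (∑ i, k i : ℕ) : ℤ) := by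
    rw [← Finset.sum_sub_distrib, Finset.sum_congr rfl fun i _ => h4 i]
    simp [mul_sub]
  push_cast at h5 h4
  have h6 : (((ℓ - 1 : ℕ) : ℤ) + 1) * ((∑ i, (k' i : ℤ)) - ∑ i, (k i : ℤ)) = 0 := by
    linear_combination -h5
  have h7 : (∑ i, (k' i : ℤ)) - ∑ i, (k i : ℤ) = 0 :=
    (mul_eq_zero.1 h6).resolve_left (by positivity)
  funext i
  have := h4 i
  rw [h7] at this
  omega

theorem theorem1 (ℓ : ℕ) (hℓ : 2 ≤ ℓ) (α : ℝ) (hα : 1 < α) (β : Fin (ℓ - 1) → ℂ)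
    (hroots : (fibPoly ℓ).roots = (α : ℂ) ::ₘ Finset.univ.val.map β) :
    ∃ ζ : ℂ → ℂ,
      (∀ s : ℂ, 0 < s.re →
        HasSum (fun n : ℕ => ((genFib ℓ (n + 1) : ℕ) : ℂ) ^ (-s)) (ζ s)) ∧
      Meromorphic ζ ∧
      (∀ s : ℂ, (∀ (k : Fin (ℓ - 1) → ℕ) (n : ℤ), s ≠ polePoint α β k n) → AnalyticAt ℂ ζ s) ∧
      (∀ (k : Fin (ℓ - 1) → ℕ) (n : ℤ),
        -1 ≤ meromorphicOrderAt ζ (polePoint α β k n) ∧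
        IsResidueAt ζ (polePoint α β k n)
          (binetWeight ℓ (α : ℂ) ^ (-polePoint α β k n) *
            Ring.choose (-polePoint α β k n) (∑ i, k i) *
            (binetWeight ℓ (α : ℂ) ^ (∑ i, k i))⁻¹ *
            (Nat.multinomial Finset.univ k : ℂ) *
            (∏ i, binetWeight ℓ (β i) ^ k i) *
            (1 / (Real.log α : ℂ)))) := by
  set r : Option (Fin (ℓ - 1)) → ℂ := fun o => o.elim (α : ℂ) β with hr
  have hr' : (fibPoly ℓ).roots = Finset.univ.val.map r := roots_eq_map_option hroots
  have hαr : (fibPoly ℓ).eval (α : ℂ) = 0 := eval_fibPoly_root hr' none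
  have hβr : ∀ i, (fibPoly ℓ).eval (β i) = 0 := fun i => eval_fibPoly_root hr' (some i)
  have hβα : ∀ i, β i ≠ α := fun i h => by
    have := roots_injective hℓ hα hαr hr' (a₁ := some i) (a₂ := none) h
    exact Option.some_ne_none i this
  obtain ⟨w, hw, hwα⟩ := binetWeight_dominant hℓ hα hαr
  obtain ⟨ζ, hζ, hmer, han, hpole⟩ := exists_meromorphic_continuation (m := ℓ - 1) (β := β) hα
    (fun i => fibPoly_root_ne_zero hℓ (hβr i))
    (fun i => norm_root_lt_one hℓ hα hαr (hβr i) (hβα i)) hw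
    (fun i => binetWeight ℓ (β i)) (F := fun n => (genFib ℓ n : ℝ))
    (fun n => by exact_mod_cast genFib_succ_pos hℓ n)
    (fun n => by
      rw [Complex.ofReal_natCast, genFib_eq_sum hℓ hα hαr hr' n, Fintype.sum_option, ← hwα]
      rfl)
    (polePoint_injective hℓ hα hroots)
  refine ⟨ζ, fun s hs => by simpa only [Complex.ofReal_natCast] using hζ s hs, hmer, han,
    fun k n => ⟨(hpole k n).1, ?_⟩⟩
  convert (hpole k n).2 using 1
  rw [hwα, binomialMonomial]
  simp only [div_pow, Finset.prod_div_distrib, Finset.prod_pow_eq_pow_sum]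
  ring
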